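/- For $n\ge 1$ let $\mathcal M_n$ be the set of pairs $(A,B)$ of complex $n\times n$ matrices with $B=B^T$, and for $(A,B)\in\mathcal M_n$ put \[\Delta(A,B)=\det\begin{bmatrix}A&\overline B\\ B&\overline A\end{bmatrix},\] where the bar denotes entrywise complex conjugation; $\Delta(A,B)$ is always a real number. Call $(A,B)\in\mathcal M_n$ elliptic if $\Delta(A,B)>0$ and hyperbolic if $\Delta(A,B)<0$. A nondegenerate smooth homotopy from $(A,B)$ to $(A',B')$ is a $C^\infty$ map $t\mapsto (A_t,B_t)$ from $[0,1]$ into $\mathcal M_n$ with $(A_0,B_0)=(A,B)$, $(A_1,B_1)=(A',B')$ and $\Delta(A_t,B_t)\neq 0$ for all $t\in[0,1]$. Write $(A_1,B_1)\oplus(A_2,B_2)=(A_1\oplus A_2,B_1\oplus B_2)$ for the direct sum (block diagonal matrices) of pairs. Proposition. Let $(A,B)\in\mathcal M_n$. (i) If $(A,B)$ is elliptic, then there exists a nondegenerate smooth homotopy from $(A,B)$ to $(I_n,0_n)$. (ii) If $(A,B)$ is hyperbolic, then there exists a nondegenerate smooth homotopy from $(A,B)$ to $(0,1)\oplus(I_{n-1},0_{n-1})$,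 where $(0,1)\in\mathcal M_1$ is the pair of $1\times 1$ matrices $0$ and $1$. -/

import Mathlib

namespace MatrixPair

/-- Ordered pairs `(A, B)` of complex `n × n` matrices. -/
abbrev Pair (n : ℕ) : Type :=
  Matrix (Fin n) (Fin n) ℂ × Matrix (Fin n) (Fin n) ℂ

/-- The space `𝓜ₙ` of pairs `(A, B)` with `B = Bᵀ`. -/
def symmPairs (n : ℕ) : Set (Pair n) :=
  {p | p.2 = p.2.transpose}

/-- The `2n × 2n` block matrix with rows `(A, conj B)` and `(B, conj A)`, where `conj` is the
entrywise complex conjugate (no transpose). -/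
def blockMatrix {n : ℕ} (p : Pair n) : Matrix (Fin n ⊕ Fin n) (Fin n ⊕ Fin n) ℂ :=
  Matrix.fromBlocks p.1 (p.2.map (starRingEnd ℂ)) p.2 (p.1.map (starRingEnd ℂ))

/-- The determinant of the block matrix of a pair. -/
noncomputable def blockDet {n : ℕ} (p : Pair n) : ℂ :=
  (blockMatrix p).det

/-- The determinant is always a real number, so that speaking of its sign makes sense. -/
theorem blockDet_im {n : ℕ} (p : Pair n) : (blockDet p).im = 0 := by
  rw [← Complex.conj_eq_iff_im]
  have h : (starRingEnd ℂ).mapMatrix (blockMatrix p) =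
      (blockMatrix p).submatrix (Equiv.sumComm (Fin n) (Fin n))
        (Equiv.sumComm (Fin n) (Fin n)) := by
    ext i j
    rcases i with i | i <;> rcases j with j | j <;> simp [blockMatrix]
  rw [blockDet, RingHom.map_det, h, Matrix.det_submatrix_equiv_self]

/-- A pair in `𝓜ₙ` is elliptic if its (real) determinant is positive. -/
def IsElliptic {n : ℕ} (p : Pair n) : Prop :=
  p ∈ symmPairs n ∧ 0 < (blockDet p).re

/-- A pair in `𝓜ₙ` is hyperbolic if its (real) determinant is negative. -/
def IsHyperbolic {n : ℕ} (p : Pair n) : Prop :=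
  p ∈ symmPairs n ∧ (blockDet p).re < 0

/-- The direct sum `(A₁, B₁) ⊕ (A₂, B₂) = (A₁ ⊕ A₂, B₁ ⊕ B₂)` of block diagonal matrices, the
rows and columns of the first summand coming first. -/
def directSum {m n : ℕ} (p : Pair m) (q : Pair n) : Pair (m + n) :=
  (Matrix.reindex finSumFinEquiv finSumFinEquiv (Matrix.fromBlocks p.1 0 0 q.1),
    Matrix.reindex finSumFinEquiv finSumFinEquiv (Matrix.fromBlocks p.2 0 0 q.2))

/-- `γ`, restricted to `[0, 1]`, is a nondegenerate smooth homotopy of pairs from `p` to `q`: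
a `C^∞` map from `[0, 1]` into `𝓜ₙ` along which the determinant never vanishes.
Only the values of `γ` on `[0, 1]` matter. -/
structure IsNondegenerateSmoothHomotopy {n : ℕ} (γ : ℝ → Pair n) (p q : Pair n) : Prop where
  smooth_fst : ∀ i j : Fin n,
    ContDiffOn ℝ ((⊤ : ℕ∞) : WithTop ℕ∞) (fun t => (γ t).1 i j) (Set.Icc 0 1)
  smooth_snd : ∀ i j : Fin n,
    ContDiffOn ℝ ((⊤ : ℕ∞) : WithTop ℕ∞) (fun t => (γ t).2 i j) (Set.Icc 0 1)
  mem_symmPairs : ∀ t ∈ Set.Icc (0 : ℝ) 1, γ t ∈ symmPairs n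
  blockDet_ne_zero : ∀ t ∈ Set.Icc (0 : ℝ) 1, blockDet (γ t) ≠ 0
  source : γ 0 = p
  target : γ 1 = q

end MatrixPair

/-! A homotopy may multiply a pair by invertible paths, `(A, B) ↦ (conj R * A * P, R * B * P)`, as
long as the second entry stays symmetric; the determinant only changes by positive factors. A small
perturbation makes `B` invertible, and congruence (`exists_congruence_one`) then makes `B = 1`. The
moves preserving `B = 1` are the consimilarities `A ↦ P⁻¹ * A * conj P`, changes of basis for the
antilinear map `v ↦ A (conj v)`.

An eigenvector of `A * conj A` generates an invariant line or plane of this map. It splits off after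
the off-diagonal block is scaled to zero, and a plane block deforms to zero, so by induction `A`
becomes diagonal (`exists_homotopic_diagonal`). Each diagonal entry of modulus `< 1` yields a
summand `(0, 1)`, each of modulus `> 1` a summand `(1, 0)`.

Two summands `(0, 1)` deform to two summands `(1, 0)` (`Homotopic.std_erase_pair`), so at most one
survives. The sign of the determinant, constant along homotopies, decides whether one does. -/

namespace MatrixPair

open Matrix Set

set_option linter.unusedSectionVars false

variable {ι κ : Type} [Fintype ι] [DecidableEq ι] [Fintype κ] [DecidableEq κ]

/-! ### Smooth matrix paths and the homotopy relation. -/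

/-- Entrywise complex conjugation of a matrix. -/
abbrev conjM {m n : Type} (A : Matrix m n ℂ) : Matrix m n ℂ := A.map (starRingEnd ℂ)

/-- The block matrix with rows `(A, conj B)` and `(B, conj A)` over any index type. -/
def blk (A B : Matrix ι ι ℂ) : Matrix (ι ⊕ ι) (ι ⊕ ι) ℂ :=
  fromBlocks A (conjM B) B (conjM A)

/-- A matrix-valued function of a real variable with smooth entries. -/
def SmoothM {m n : Type} (A : ℝ → Matrix m n ℂ) : Prop :=
  ∀ i j, ContDiff ℝ ((⊤ : ℕ∞) : WithTop ℕ∞) (fun t => A t i j)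

/-- Two pairs are homotopic if they are joined by a smooth path of pairs with symmetric second
component which is nondegenerate over `[0, 1]`. -/
def Homotopic (A B A' B' : Matrix ι ι ℂ) : Prop :=
  ∃ X Y : ℝ → Matrix ι ι ℂ, SmoothM X ∧ SmoothM Y ∧
    (∀ t ∈ Icc (0 : ℝ) 1, (Y t)ᵀ = Y t ∧ (blk (X t) (Y t)).det ≠ 0) ∧
    X 0 = A ∧ Y 0 = B ∧ X 1 = A' ∧ Y 1 = B'

lemma conjM_mul (A B : Matrix ι ι ℂ) : conjM (A * B) = conjM A * conjM B :=
  Matrix.map_mul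

lemma conjM_conjM {m n : Type} (A : Matrix m n ℂ) : conjM (conjM A) = A := by
  ext; simp

lemma det_conjM (A : Matrix ι ι ℂ) : (conjM A).det = starRingEnd ℂ A.det :=
  ((starRingEnd ℂ).map_det A).symm

lemma conjM_one : conjM (1 : Matrix ι ι ℂ) = 1 := by
  simp

namespace SmoothM

variable {m n k : Type} [Fintype n]

lemma const (A : Matrix m n ℂ) : SmoothM (fun _ => A) := fun _ _ => contDiff_const

lemma add {A B : ℝ → Matrix m n ℂ} (hA : SmoothM A) (hB : SmoothM B) :
    SmoothM (fun t => A t + B t) := fun i j => (hA i j).add (hB i j)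

lemma sub {A B : ℝ → Matrix m n ℂ} (hA : SmoothM A) (hB : SmoothM B) :
    SmoothM (fun t => A t - B t) := fun i j => (hA i j).sub (hB i j)

lemma smul {f : ℝ → ℂ} {A : ℝ → Matrix m n ℂ} (hf : ContDiff ℝ ((⊤ : ℕ∞) : WithTop ℕ∞) f)
    (hA : SmoothM A) : SmoothM (fun t => f t • A t) := fun i j => hf.mul (hA i j)

lemma mul {A : ℝ → Matrix m n ℂ} {B : ℝ → Matrix n k ℂ} (hA : SmoothM A) (hB : SmoothM B) :
    SmoothM (fun t => A t * B t) := fun i j => by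
  simp only [Matrix.mul_apply]
  exact ContDiff.sum fun l _ => (hA i l).mul (hB l j)

lemma transpose {A : ℝ → Matrix m n ℂ} (hA : SmoothM A) : SmoothM (fun t => (A t)ᵀ) :=
  fun i j => hA j i

lemma conj {A : ℝ → Matrix m n ℂ} (hA : SmoothM A) : SmoothM (fun t => conjM (A t)) :=
  fun i j => Complex.conjCLE.contDiff.comp (hA i j)

lemma comp {A : ℝ → Matrix m n ℂ} (hA : SmoothM A) {f : ℝ → ℝ}
    (hf : ContDiff ℝ ((⊤ : ℕ∞) : WithTop ℕ∞) f) : SmoothM (fun t => A (f t)) :=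
  fun i j => (hA i j).comp hf

lemma submatrix {A : ℝ → Matrix m n ℂ} (hA : SmoothM A) {m' n' : Type} (f : m' → m)
    (g : n' → n) : SmoothM (fun t => (A t).submatrix f g) := fun i j => hA (f i) (g j)

lemma det {A : ℝ → Matrix ι ι ℂ} (hA : SmoothM A) :
    ContDiff ℝ ((⊤ : ℕ∞) : WithTop ℕ∞) (fun t => (A t).det) := by
  simp only [Matrix.det_apply]
  exact ContDiff.sum fun σ _ => (contDiff_prod fun i _ => hA _ _).const_smul _

lemma adjugate {A : ℝ → Matrix ι ι ℂ} (hA : SmoothM A) : SmoothM (fun t => (A t).adjugate) :=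
  fun i j => by
    simp only [Matrix.adjugate_apply]
    refine det fun a b => ?_
    by_cases h : a = j
    · subst h; simpa using contDiff_const
    · simpa [Matrix.updateRow_ne h] using hA a b

lemma diagonal {f : ι → ℝ → ℂ} (hf : ∀ i, ContDiff ℝ ((⊤ : ℕ∞) : WithTop ℕ∞) (f i)) :
    SmoothM (fun t => Matrix.diagonal fun i => f i t) := fun i j => by
  by_cases h : i = j
  · subst h; simpa using hf i
  · simpa [Matrix.diagonal_apply_ne _ h] using contDiff_const

lemma fromBlocks {l o : Type} {A : ℝ → Matrix m n ℂ} {B : ℝ → Matrix m l ℂ}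
    {C : ℝ → Matrix o n ℂ} {D : ℝ → Matrix o l ℂ} (hA : SmoothM A) (hB : SmoothM B)
    (hC : SmoothM C) (hD : SmoothM D) :
    SmoothM (fun t => Matrix.fromBlocks (A t) (B t) (C t) (D t)) := by
  rintro (i | i) (j | j)
  exacts [hA i j, hB i j, hC i j, hD i j]

lemma blk {A B : ℝ → Matrix ι ι ℂ} (hA : SmoothM A) (hB : SmoothM B) :
    SmoothM (fun t => blk (A t) (B t)) :=
  fromBlocks hA hB.conj hB hA.conj

end SmoothM

lemma contDiff_ofReal {n : WithTop ℕ∞} : ContDiff ℝ n (fun t : ℝ => (t : ℂ)) :=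
  Complex.ofRealCLM.contDiff

namespace Homotopic

variable {A B A' B' A'' B'' : Matrix ι ι ℂ}

lemma refl (hB : Bᵀ = B) (h : (blk A B).det ≠ 0) : Homotopic A B A B :=
  ⟨fun _ => A, fun _ => B, .const A, .const B, fun _ _ => ⟨hB, h⟩, rfl, rfl, rfl, rfl⟩

lemma symm (h : Homotopic A B A' B') : Homotopic A' B' A B := by
  obtain ⟨X, Y, hX, hY, h, h1, h2, h3, h4⟩ := h
  have hs : ContDiff ℝ ((⊤ : ℕ∞) : WithTop ℕ∞) (fun t : ℝ => 1 - t) :=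
    contDiff_const.sub contDiff_id
  exact ⟨fun t => X (1 - t), fun t => Y (1 - t), hX.comp hs, hY.comp hs,
    fun t ht => h _ ⟨by linarith [ht.2], by linarith [ht.1]⟩, by simpa, by simpa, by simpa,
    by simpa⟩

lemma trans (h : Homotopic A B A' B') (h' : Homotopic A' B' A'' B'') :
    Homotopic A B A'' B'' := by
  obtain ⟨X, Y, hX, hY, h, h1, h2, h3, h4⟩ := h
  obtain ⟨X', Y', hX', hY', h', h1', h2', h3', h4'⟩ := h'
  -- `f` moves only on `[0, 1/3]` and `g` only on `[2/3, 1]`. One of the two paths thus always rests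
  -- at the junction, and subtracting the junction value gives a smooth concatenation.
  set f : ℝ → ℝ := fun t => Real.smoothTransition (3 * t) with hf
  set g : ℝ → ℝ := fun t => Real.smoothTransition (3 * t - 2) with hg
  have sf : ContDiff ℝ ((⊤ : ℕ∞) : WithTop ℕ∞) f :=
    Real.smoothTransition.contDiff.comp (contDiff_const.mul contDiff_id)
  have sg : ContDiff ℝ ((⊤ : ℕ∞) : WithTop ℕ∞) g :=
    Real.smoothTransition.contDiff.comp ((contDiff_const.mul contDiff_id).sub contDiff_const)
  have f0 : f 0 = 0 := by simp [hf]
  have f1 : f 1 = 1 := Real.smoothTransition.one_of_one_le (by norm_num)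
  have g0 : g 0 = 0 := Real.smoothTransition.zero_of_nonpos (by norm_num)
  have g1 : g 1 = 1 := Real.smoothTransition.one_of_one_le (by norm_num)
  refine ⟨fun t => X (f t) + X' (g t) - A', fun t => Y (f t) + Y' (g t) - B',
    ((hX.comp sf).add (hX'.comp sg)).sub (.const _),
    ((hY.comp sf).add (hY'.comp sg)).sub (.const _), fun t _ => ?_, ?_, ?_, ?_, ?_⟩
  · rcases le_total t (1 / 2) with ht | ht
    · have e : g t = 0 := Real.smoothTransition.zero_of_nonpos (by linarith)
      simpa [e, h1', h2'] using
        h (f t) ⟨Real.smoothTransition.nonneg _, Real.smoothTransition.le_one _⟩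
    · have e : f t = 1 := Real.smoothTransition.one_of_one_le (by linarith)
      simpa [e, h3, h4] using
        h' (g t) ⟨Real.smoothTransition.nonneg _, Real.smoothTransition.le_one _⟩
  all_goals simp [f0, f1, g0, g1, h1, h2, h3, h4, h1', h2', h3', h4']

lemma det_left (h : Homotopic A B A' B') : (blk A B).det ≠ 0 := by
  obtain ⟨X, Y, hX, hY, h, h1, h2, h3, h4⟩ := h
  rw [← h2, ← h1]; exact (h 0 (by simp)).2

end Homotopic

/-! ### Determinants of block matrices. -/

/-- Nondegeneracy may be tested on the kernel of the block matrix. -/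
lemma det_blk_ne_zero_of_ker {A B : Matrix ι ι ℂ}
    (h : ∀ v w : ι → ℂ, A *ᵥ v + conjM B *ᵥ w = 0 → B *ᵥ v + conjM A *ᵥ w = 0 →
      v = 0 ∧ w = 0) : (blk A B).det ≠ 0 := by
  intro h0
  obtain ⟨x, hx, hx0⟩ := Matrix.exists_mulVec_eq_zero_iff.2 h0
  rw [blk, Matrix.fromBlocks_mulVec] at hx0
  have h1 := h (x ∘ Sum.inl) (x ∘ Sum.inr)
    (funext fun i => congrFun hx0 (Sum.inl i)) (funext fun i => congrFun hx0 (Sum.inr i))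
  apply hx
  funext i
  rcases i with i | i
  · exact congrFun h1.1 i
  · exact congrFun h1.2 i

lemma blk_twoSided (Q A B P : Matrix ι ι ℂ) :
    blk (Q * A * P) (conjM Q * B * P) =
      fromBlocks Q 0 0 (conjM Q) * blk A B * fromBlocks P 0 0 (conjM P) := by
  simp only [blk, fromBlocks_multiply, conjM_mul, conjM_conjM]
  simp

lemma det_blk_twoSided (Q A B P : Matrix ι ι ℂ) :
    (blk (Q * A * P) (conjM Q * B * P)).det =
      (Q.det * starRingEnd ℂ Q.det) * (blk A B).det * (P.det * starRingEnd ℂ P.det) := by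
  rw [blk_twoSided, det_mul, det_mul, det_fromBlocks_zero₂₁, det_fromBlocks_zero₂₁, det_conjM,
    det_conjM]

/-- Grouping the indices by summand makes the matrix block upper triangular, so `C` has no
influence; this is what lets `offDiag` scale `C` to zero. -/
lemma det_blk_fromBlocks (A B : Matrix ι ι ℂ) (C : Matrix ι κ ℂ) (D E : Matrix κ κ ℂ) :
    (blk (fromBlocks A C 0 D) (fromBlocks B 0 0 E)).det =
      (blk A B).det * (blk D E).det := by
  have : (blk (fromBlocks A C 0 D) (fromBlocks B 0 0 E)).submatrix
      (Equiv.sumSumSumComm ι ι κ κ) (Equiv.sumSumSumComm ι ι κ κ) =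
      fromBlocks (blk A B) (fromBlocks C 0 0 (conjM C)) 0 (blk D E) := by
    ext i j
    rcases i with (i | i) | (i | i) <;> rcases j with (j | j) | (j | j) <;> simp [blk]
  rw [← det_submatrix_equiv_self (Equiv.sumSumSumComm ι ι κ κ), this, det_fromBlocks_zero₂₁]

lemma det_blk_submatrix (A B : Matrix ι ι ℂ) (e : κ ≃ ι) :
    (blk (A.submatrix e e) (B.submatrix e e)).det = (blk A B).det := by
  rw [← det_submatrix_equiv_self (Equiv.sumCongr e e) (blk A B)]
  congr 1
  ext i j
  rcases i with i | i <;> rcases j with j | j <;> simp [blk]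

namespace Homotopic

lemma submatrix {A B A' B' : Matrix ι ι ℂ} (h : Homotopic A B A' B') (e : κ ≃ ι) :
    Homotopic (A.submatrix e e) (B.submatrix e e) (A'.submatrix e e) (B'.submatrix e e) := by
  obtain ⟨X, Y, hX, hY, h, rfl, rfl, rfl, rfl⟩ := h
  refine ⟨fun t => (X t).submatrix e e, fun t => (Y t).submatrix e e, hX.submatrix _ _,
    hY.submatrix _ _, fun t ht => ⟨?_, ?_⟩, rfl, rfl, rfl, rfl⟩
  · rw [transpose_submatrix, (h t ht).1]
  · rw [det_blk_submatrix]; exact (h t ht).2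

lemma fromBlocks {A B A' B' : Matrix ι ι ℂ} {D E D' E' : Matrix κ κ ℂ}
    (h : Homotopic A B A' B') (h' : Homotopic D E D' E') :
    Homotopic (fromBlocks A 0 0 D) (fromBlocks B 0 0 E) (fromBlocks A' 0 0 D')
      (fromBlocks B' 0 0 E') := by
  obtain ⟨X, Y, hX, hY, h, rfl, rfl, rfl, rfl⟩ := h
  obtain ⟨X', Y', hX', hY', h', rfl, rfl, rfl, rfl⟩ := h'
  refine ⟨fun t => .fromBlocks (X t) 0 0 (X' t), fun t => .fromBlocks (Y t) 0 0 (Y' t),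
    hX.fromBlocks (.const _) (.const _) hX', hY.fromBlocks (.const _) (.const _) hY',
    fun t ht => ⟨?_, ?_⟩, rfl, rfl, rfl, rfl⟩
  · simp [fromBlocks_transpose, (h t ht).1, (h' t ht).1]
  · rw [det_blk_fromBlocks]
    exact mul_ne_zero (h t ht).2 (h' t ht).2

lemma offDiag {A B : Matrix ι ι ℂ} {D E : Matrix κ κ ℂ} (C : Matrix ι κ ℂ)
    (hB : Bᵀ = B) (hE : Eᵀ = E) (h : (blk A B).det ≠ 0) (h' : (blk D E).det ≠ 0) :
    Homotopic (.fromBlocks A C 0 D) (.fromBlocks B 0 0 E) (.fromBlocks A 0 0 D)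
      (.fromBlocks B 0 0 E) := by
  refine ⟨fun t => .fromBlocks A ((1 - t : ℂ) • C) 0 D, fun _ => .fromBlocks B 0 0 E,
    .fromBlocks (.const _) (.smul (contDiff_const.sub contDiff_ofReal) (.const _)) (.const _)
      (.const _), .const _, fun t ht => ⟨?_, ?_⟩, by simp, rfl, by simp, rfl⟩
  · simp [fromBlocks_transpose, hB, hE]
  · rw [det_blk_fromBlocks]
    exact mul_ne_zero h h'

end Homotopic

/-! ### Smooth paths avoiding zeros of determinants. -/

/-- The complex plane minus the roots of a polynomial is smoothly path connected
(here: from `0` to `1`). -/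
lemma exists_smooth_path_avoiding_roots (p : Polynomial ℂ) (h0 : p.eval 0 ≠ 0)
    (h1 : p.eval 1 ≠ 0) :
    ∃ z : ℝ → ℂ, ContDiff ℝ ((⊤ : ℕ∞) : WithTop ℕ∞) z ∧ z 0 = 0 ∧ z 1 = 1 ∧
      ∀ t ∈ Icc (0 : ℝ) 1, p.eval (z t) ≠ 0 := by
  have hp : p ≠ 0 := by rintro rfl; simp at h0
  -- The arcs `t + c * t * (1 - t) * I`, for real `c`, meet only at their endpoints. A root on an
  -- open arc determines `c` by this quotient, so only finitely many `c` are bad.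
  obtain ⟨c, hc⟩ := Infinite.exists_notMem_finset
    (p.roots.toFinset.image fun r => r.im / (r.re * (1 - r.re)))
  refine ⟨fun t => t + c * (t * (1 - t)) * Complex.I, ?_, by simp, by simp, ?_⟩
  · have := @contDiff_ofReal ((⊤ : ℕ∞) : WithTop ℕ∞)
    exact this.add ((contDiff_const.mul (this.mul (contDiff_const.sub this))).mul contDiff_const)
  · intro t ht h
    rcases eq_or_lt_of_le ht.1 with rfl | ht0
    · simp at h; exact h0 h
    rcases eq_or_lt_of_le ht.2 with rfl | ht1
    · simp at h; exact h1 h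
    apply hc
    simp only [Finset.mem_image, Multiset.mem_toFinset]
    refine ⟨_, (Polynomial.mem_roots hp).2 h, ?_⟩
    have e : (t + c * (t * (1 - t)) * Complex.I : ℂ) = ⟨t, c * (t * (1 - t))⟩ := by
      apply Complex.ext <;> simp [-Complex.ofReal_mul, ← Complex.ofReal_one, ← Complex.ofReal_sub]
    change Complex.im _ / (Complex.re _ * (1 - Complex.re _)) = c
    simp only [e]
    have : t * (1 - t) ≠ 0 := mul_ne_zero ht0.ne' (by linarith)
    field_simp

/-- The general linear group is smoothly path connected. -/
lemma exists_smooth_path_det_ne_zero (P : Matrix ι ι ℂ) (hP : P.det ≠ 0) :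
    ∃ X : ℝ → Matrix ι ι ℂ, SmoothM X ∧ X 0 = 1 ∧ X 1 = P ∧
      ∀ t ∈ Icc (0 : ℝ) 1, (X t).det ≠ 0 := by
  -- On the complex line through `1` and `P` the determinant is a polynomial in the parameter,
  -- nonzero at both ends.
  set M : Matrix ι ι (Polynomial ℂ) :=
    1 + (Polynomial.X : Polynomial ℂ) • (P - 1).map Polynomial.C with hM
  have key : ∀ z : ℂ, M.det.eval z = (1 + z • (P - 1)).det := by
    intro z
    rw [← Polynomial.coe_evalRingHom, RingHom.map_det]
    congr 1
    ext i j
    by_cases h : i = j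
    · subst h; simp [hM]
    · simp only [hM]
      simp [h]
      exact mul_comm _ _
  obtain ⟨z, hz, z0, z1, h⟩ := exists_smooth_path_avoiding_roots M.det (by simp [key])
    (by simpa [key] using hP)
  exact ⟨fun t => 1 + z t • (P - 1), (SmoothM.const _).add (.smul hz (.const _)), by simp [z0],
    by simp [z1], fun t ht => key _ ▸ h t ht⟩

/-! ### Congruence and consimilarity as homotopies. -/

namespace Homotopic

/-- Moving a pair by invertible complex linear maps on both sides. -/
lemma twoSided {A B : Matrix ι ι ℂ} (h : (blk A B).det ≠ 0) {R P : ℝ → Matrix ι ι ℂ}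
    (hR : SmoothM R) (hP : SmoothM P) (hR0 : R 0 = 1) (hP0 : P 0 = 1)
    (hdet : ∀ t ∈ Icc (0 : ℝ) 1, (R t).det ≠ 0 ∧ (P t).det ≠ 0)
    (hsymm : ∀ t ∈ Icc (0 : ℝ) 1, (R t * B * P t)ᵀ = R t * B * P t) :
    Homotopic A B (conjM (R 1) * A * P 1) (R 1 * B * P 1) := by
  refine ⟨fun t => conjM (R t) * A * P t, fun t => R t * B * P t,
    (hR.conj.mul (.const _)).mul hP, (hR.mul (.const _)).mul hP,
    fun t ht => ⟨hsymm t ht, ?_⟩, ?_, ?_, rfl, rfl⟩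
  · have := det_blk_twoSided (conjM (R t)) A B (P t)
    rw [conjM_conjM] at this
    rw [this, det_conjM]
    simp [h, hdet t ht]
  · simp [hR0, hP0]
  · simp [hR0, hP0]

lemma congruence {A B : Matrix ι ι ℂ} (hB : Bᵀ = B) (h : (blk A B).det ≠ 0)
    {P : Matrix ι ι ℂ} (hP : P.det ≠ 0) : Homotopic A B (Pᴴ * A * P) (Pᵀ * B * P) := by
  obtain ⟨X, hX, X0, X1, hd⟩ := exists_smooth_path_det_ne_zero P hP
  have := twoSided h hX.transpose hX (by simp [X0]) X0 (fun t ht => by simpa using hd t ht)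
    (fun t ht => by simp [hB, Matrix.mul_assoc])
  rw [X1] at this
  exact this

lemma consimilarity {A : Matrix ι ι ℂ} (h : (blk A 1).det ≠ 0) {P : Matrix ι ι ℂ}
    (hP : P.det ≠ 0) : Homotopic A 1 (P⁻¹ * A * conjM P) 1 := by
  have hQ : (conjM P).det ≠ 0 := by simpa [det_conjM] using hP
  obtain ⟨X, hX, X0, X1, hd⟩ := exists_smooth_path_det_ne_zero _ hQ
  -- The left factor is `exp (t * w) • adjugate (X t)`: its product with `X t` is scalar, hence
  -- symmetric, and `w` makes it the exact inverse at `t = 1`. The adjugate, unlike the inverse, is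
  -- smooth even where `X t` is singular.
  set w := -Complex.log (conjM P).det
  have hw : ContDiff ℝ ((⊤ : ℕ∞) : WithTop ℕ∞) (fun t : ℝ => Complex.exp (t * w)) :=
    (contDiff_ofReal.mul contDiff_const).cexp
  have := twoSided h (SmoothM.smul hw hX.adjugate) hX (by simp [X0]) X0
    (fun t ht => ⟨by simp [Matrix.det_adjugate, hd t ht], hd t ht⟩)
    (fun t ht => by simp [Matrix.adjugate_mul])
  have e : Complex.exp w • (conjM P).adjugate = (conjM P)⁻¹ := by
    rw [Matrix.inv_def, Complex.exp_neg, Complex.exp_log hQ, Ring.inverse_eq_inv']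
  simp only [X1, Complex.ofReal_one, one_mul, e, mul_one] at this
  have hinv := Matrix.nonsing_inv_mul _ (isUnit_iff_ne_zero.2 hQ)
  have e' : conjM (conjM P)⁻¹ = P⁻¹ := by
    refine (Matrix.inv_eq_left_inv ?_).symm
    rw [← conjM_conjM P, ← conjM_mul, conjM_conjM, hinv, conjM_one]
  rwa [hinv, e'] at this

end Homotopic

/-! ### Reduction to second entry `1`. -/

/-- A pair may be moved to one with invertible symmetric part. -/
lemma exists_homotopic_det_ne_zero {A B : Matrix ι ι ℂ} (hB : Bᵀ = B)
    (h : (blk A B).det ≠ 0) :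
    ∃ B' : Matrix ι ι ℂ, B'ᵀ = B' ∧ B'.det ≠ 0 ∧ Homotopic A B A B' := by
  have hc : Continuous fun s : ℝ => (blk A (B + (s : ℂ) • 1)).det :=
    (SmoothM.det (SmoothM.blk (.const _)
      ((SmoothM.const _).add (.smul contDiff_ofReal (.const _))))).continuous
  have h0 : ∀ᶠ s : ℝ in nhds 0, (blk A (B + (s : ℂ) • 1)).det ≠ 0 :=
    hc.continuousAt.eventually_ne (by simpa using h)
  obtain ⟨δ, hδ, hball⟩ := Metric.eventually_nhds_iff.1 h0
  have hfin : {s : ℝ | (B + (s : ℂ) • 1).det = 0}.Finite := by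
    have := ((-B).charpoly.roots.toFinset.finite_toSet).preimage
      Complex.ofReal_injective.injOn
    refine this.subset fun s hs => ?_
    simp only [mem_preimage, Finset.mem_coe, Multiset.mem_toFinset]
    rw [Polynomial.mem_roots (Matrix.charpoly_monic _).ne_zero, Polynomial.IsRoot,
      Matrix.eval_charpoly]
    rw [← hs.out]
    congr 1
    simp [Matrix.smul_one_eq_diagonal, add_comm]
  -- Nondegeneracy is open, so it holds for all shifts below `δ`; only finitely many shifts,
  -- eigenvalues of `-B`, leave `B + s` singular.
  obtain ⟨s, hs, hs'⟩ := ((Ioo_infinite hδ).sdiff hfin).nonempty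
  refine ⟨B + (s : ℂ) • 1, by simp [hB], hs', fun _ => A, fun t => B + ((t * s : ℝ) : ℂ) • 1,
    .const _, (SmoothM.const _).add (.smul (contDiff_ofReal.comp
      (contDiff_id.mul contDiff_const)) (.const _)), fun t ht => ⟨by simp [hB], ?_⟩, rfl,
    by simp, rfl, by simp⟩
  apply hball
  rw [Real.dist_eq, sub_zero, abs_of_nonneg (mul_nonneg ht.1 hs.1.le)]
  nlinarith [ht.1, ht.2, hs.1, hs.2]

/-- Invertible complex symmetric matrices are congruent to the identity. -/
lemma exists_congruence_one {B : Matrix ι ι ℂ} (hB : Bᵀ = B) (h : B.det ≠ 0) :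
    ∃ P : Matrix ι ι ℂ, P.det ≠ 0 ∧ Pᵀ * B * P = 1 := by
  have assoc : ∀ C : Matrix ι ι ℂ, Cᵀ = C →
      QuadraticMap.associated (R := ℂ) C.toQuadraticForm' = Matrix.toLinearMap₂' ℂ C := by
    intro C hC
    refine QuadraticMap.associated_left_inverse ℂ fun x y => ?_
    simp only [Matrix.toLinearMap₂'_apply']
    rw [dotProduct_comm, ← vecMul_transpose, hC, dotProduct_mulVec]
  have key : ∀ C : Matrix ι ι ℂ, Cᵀ = C → C.toQuadraticForm'.toMatrix' = C := by
    intro C hC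
    rw [QuadraticForm.toMatrix', assoc C hC, LinearMap.toMatrix'_toLinearMap₂']
  have sep : ∀ C : Matrix ι ι ℂ, Cᵀ = C → C.det ≠ 0 →
      (QuadraticMap.associated (R := ℂ) C.toQuadraticForm').SeparatingLeft := by
    intro C hC h
    rw [assoc C hC]
    exact LinearMap.separatingLeft_toLinearMap₂'_of_det_ne_zero' h
  -- Over `ℂ`, nondegenerate quadratic forms of equal rank are equivalent.
  obtain ⟨e⟩ := QuadraticForm.equivalent_of_isAlgClosed _ _
    (sep 1 (by simp) (by simp)) (sep B hB h)
  have hcomp : B.toQuadraticForm'.comp (e.toLinearEquiv : (ι → ℂ) →ₗ[ℂ] (ι → ℂ)) =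
      (1 : Matrix ι ι ℂ).toQuadraticForm' := by
    ext x
    exact e.map_app x
  have := congrArg QuadraticForm.toMatrix' hcomp
  rw [QuadraticForm.toMatrix'_comp, key B hB, key 1 (by simp)] at this
  refine ⟨_, ?_, this⟩
  intro h0
  have := congrArg Matrix.det this
  simp [h0] at this

/-! ### Diagonal pairs and cancellation of hyperbolic summands. -/

lemma det_blk_diagonal (a b : ι → ℂ) :
    (blk (diagonal a) (diagonal b)).det =
      ((∏ i, (Complex.normSq (a i) - Complex.normSq (b i)) : ℝ) : ℂ) := by
  set e : Fin 2 × ι ≃ ι ⊕ ι :=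
    (finTwoEquiv.prodCongr (Equiv.refl ι)).trans (Equiv.boolProdEquivSum ι) with he
  have : (blk (diagonal a) (diagonal b)).submatrix e e = blockDiagonal fun i =>
      !![a i, starRingEnd ℂ (b i); b i, starRingEnd ℂ (a i)] := by
    ext ⟨i, k⟩ ⟨j, l⟩
    by_cases h : k = l
    · subst h
      fin_cases i <;> fin_cases j <;> simp [he, blk, Equiv.boolProdEquivSum, finTwoEquiv]
    · fin_cases i <;> fin_cases j <;>
        simp [he, blk, Equiv.boolProdEquivSum, finTwoEquiv, blockDiagonal_apply, h]
  rw [← det_submatrix_equiv_self e, this, det_blockDiagonal]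
  push_cast
  refine Finset.prod_congr rfl fun i _ => ?_
  rw [det_fin_two_of, Complex.mul_conj, mul_comm, Complex.mul_conj, ]

lemma Homotopic.diagonal_path {f g : ι → ℝ → ℂ}
    (hf : ∀ i, ContDiff ℝ ((⊤ : ℕ∞) : WithTop ℕ∞) (f i))
    (hg : ∀ i, ContDiff ℝ ((⊤ : ℕ∞) : WithTop ℕ∞) (g i))
    (h : ∀ i, ∀ t ∈ Icc (0 : ℝ) 1, ‖f i t‖ ≠ ‖g i t‖) :
    Homotopic (diagonal fun i => f i 0) (diagonal fun i => g i 0) (diagonal fun i => f i 1)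
      (diagonal fun i => g i 1) := by
  refine ⟨_, _, .diagonal hf, .diagonal hg, fun t ht => ⟨by simp, ?_⟩, rfl, rfl, rfl, rfl⟩
  rw [det_blk_diagonal, Complex.ofReal_ne_zero, Finset.prod_ne_zero_iff]
  intro i _ h0
  apply h i t ht
  rw [sub_eq_zero, Complex.normSq_eq_norm_sq, Complex.normSq_eq_norm_sq] at h0
  exact (pow_left_inj₀ (norm_nonneg _) (norm_nonneg _) two_ne_zero).1 h0

/-- The diagonal normal form: the sum of `(0, 1)` over the indices in `s` and of `(1, 0)` over
the other indices. -/
def stdFst (s : Finset ι) : Matrix ι ι ℂ := diagonal fun i => if i ∈ s then 0 else 1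

/-- The symmetric part of the diagonal normal form. -/
def stdSnd (s : Finset ι) : Matrix ι ι ℂ := diagonal fun i => if i ∈ s then 1 else 0

lemma det_blk_std (s : Finset ι) : (blk (stdFst s) (stdSnd s)).det = (-1) ^ s.card := by
  rw [stdFst, stdSnd, det_blk_diagonal]
  have : ∀ i, Complex.normSq (if i ∈ s then 0 else 1) -
      Complex.normSq (if i ∈ s then 1 else 0) = if i ∈ s then -1 else 1 := by
    intro i; split_ifs <;> simp
  rw [Finset.prod_congr rfl fun i _ => this i, Finset.prod_ite]
  simp

lemma Homotopic.det_right {A B A' B' : Matrix ι ι ℂ} (h : Homotopic A B A' B') :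
    (blk A' B').det ≠ 0 := h.symm.det_left

lemma exists_homotopic_std_of_diagonal {d : ι → ℂ} (h : (blk (diagonal d) 1).det ≠ 0) :
    ∃ s : Finset ι, Homotopic (diagonal d) 1 (stdFst s) (stdSnd s) := by
  have hd : ∀ i, ‖d i‖ ≠ 1 := by
    intro i hi
    apply h
    rw [← diagonal_one, det_blk_diagonal, Complex.ofReal_eq_zero]
    exact Finset.prod_eq_zero (Finset.mem_univ i) (by simp [Complex.normSq_eq_norm_sq, hi])
  refine ⟨Finset.univ.filter fun i => ‖d i‖ < 1, ?_⟩
  have sm : ContDiff ℝ ((⊤ : ℕ∞) : WithTop ℕ∞) (fun t : ℝ => (1 - t : ℂ)) :=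
    contDiff_const.sub contDiff_ofReal
  -- If `‖d i‖ < 1`, the first entry shrinks to `0` against `1`. Otherwise it runs through the
  -- powers of exponent `1 - t` of `d i`, of modulus at least `1`, while the second entry is `1 -
  -- t`; the two moduli never agree.
  have := Homotopic.diagonal_path
    (f := fun i t => if ‖d i‖ < 1 then (1 - t : ℂ) * d i
      else Complex.exp ((1 - t : ℂ) * Complex.log (d i)))
    (g := fun i t => if ‖d i‖ < 1 then 1 else (1 - t : ℂ)) ?_ ?_ ?_
  · convert this using 1
    · congr 1; funext i
      by_cases hi : ‖d i‖ < 1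
      · simp [hi]
      · have : d i ≠ 0 := by rintro h0; simp [h0] at hi
        simp [hi, Complex.exp_log this]
    · rw [← diagonal_one]; congr 1; funext i; simp
    · rw [stdFst]; congr 1; funext i; simp
    · rw [stdSnd]; congr 1; funext i; simp
  · intro i
    by_cases hi : ‖d i‖ < 1 <;> simp only [hi, if_true, if_false]
    · exact sm.mul contDiff_const
    · exact (sm.mul contDiff_const).cexp
  · intro i
    by_cases hi : ‖d i‖ < 1 <;> simp only [hi, if_true, if_false]
    · exact contDiff_const
    · exact sm
  · intro i t ht
    have e : (1 - t : ℂ) = ((1 - t : ℝ) : ℂ) := by push_cast; rfl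
    have ht1 : 0 ≤ 1 - t := by linarith [ht.2]
    by_cases hi : ‖d i‖ < 1 <;> simp only [hi, if_true, if_false, e]
    · rw [norm_mul, norm_one, Complex.norm_real, Real.norm_of_nonneg ht1]
      nlinarith [norm_nonneg (d i), ht.1]
    · rw [Complex.norm_exp, Complex.norm_real, Real.norm_of_nonneg ht1, Complex.re_ofReal_mul,
        Complex.log_re]
      have h1 : 1 < ‖d i‖ := lt_of_le_of_ne (not_lt.1 hi) (hd i).symm
      have hl := Real.log_pos h1
      rcases eq_or_lt_of_le ht1 with h0 | h0
      · simp [← h0]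
      · have := Real.add_one_lt_exp (mul_pos h0 hl).ne'
        have := mul_pos h0 hl
        linarith [ht.1]

/-- For real `X`, `Y` the kernel equations decouple into `(X + Y) (v + w) = 0` and `(X - Y) (v - w)
= 0`. On the indices `i`, `j` these matrices are `1 + t(1-t) J` and `(2t-1) + t(1-t) J`, with `J`
the rotation by a right angle up to sign. Their determinants are `hq` and `hr`; the term in `J`
saves the second one at `t = 1/2`. -/
lemma Homotopic.std_erase_pair {s : Finset ι} {i j : ι} (hi : i ∈ s) (hj : j ∈ s) (hij : i ≠ j) :
    Homotopic (stdFst s) (stdSnd s) (stdFst ((s.erase i).erase j))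
      (stdSnd ((s.erase i).erase j)) := by
  set F : ι → ℝ → ℂ := fun k t => if k = i ∨ k = j then (t : ℂ) else if k ∈ s then 0 else 1
  set G : ι → ℝ → ℂ := fun k t => if k = i ∨ k = j then (1 - t : ℂ) else if k ∈ s then 1 else 0
  set N : Matrix ι ι ℂ := single i j 1 - single j i 1
  have sF : ∀ k, ContDiff ℝ ((⊤ : ℕ∞) : WithTop ℕ∞) (F k) := by
    intro k
    by_cases hk : k = i ∨ k = j <;> simp only [F, hk, if_true, if_false]
    exacts [contDiff_ofReal, contDiff_const]
  have sm : ContDiff ℝ ((⊤ : ℕ∞) : WithTop ℕ∞) (fun t : ℝ => (1 - t : ℂ)) :=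
    contDiff_const.sub contDiff_ofReal
  have sG : ∀ k, ContDiff ℝ ((⊤ : ℕ∞) : WithTop ℕ∞) (G k) := by
    intro k
    by_cases hk : k = i ∨ k = j <;> simp only [G, hk, if_true, if_false]
    exacts [sm, contDiff_const]
  refine ⟨fun t => diagonal (fun k => F k t) + ((t : ℂ) * (1 - t)) • N,
    fun t => diagonal (fun k => G k t),
    (SmoothM.diagonal sF).add (.smul (contDiff_ofReal.mul sm) (.const _)), .diagonal sG,
    fun t ht => ⟨by simp, det_blk_ne_zero_of_ker fun v w h1 h2 => ?_⟩, ?_, ?_, ?_, ?_⟩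
  · have hF : ∀ k, starRingEnd ℂ (F k t) = F k t := by
      intro k; simp only [F]; split_ifs <;> simp
    have hG : ∀ k, starRingEnd ℂ (G k t) = G k t := by
      intro k; simp only [G]; split_ifs <;> simp
    have hN : ∀ (x : ι → ℂ) k, (N *ᵥ x) k =
        (if k = i then x j else 0) - if k = j then x i else 0 := by
      intro x k
      simp [N, sub_mulVec, single_mulVec, Function.update_apply]
    have cX : conjM (diagonal (fun k => F k t) + ((t : ℂ) * (1 - t)) • N) =
        diagonal (fun k => F k t) + ((t : ℂ) * (1 - t)) • N := by
      ext k l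
      by_cases hkl : k = l
      · subst hkl; simp [hF, N, single_apply]
      · simp [hkl, N, single_apply]
    have cY : conjM (diagonal fun k => G k t) = diagonal fun k => G k t := by
      rw [conjM, diagonal_map (by simp)]; congr 1; funext k; exact hG k
    rw [cY] at h1
    rw [cX] at h2
    have e1 : ∀ k, F k t * v k + t * (1 - t) * ((if k = i then v j else 0) -
        if k = j then v i else 0) + G k t * w k = 0 := by
      intro k
      simpa [add_mulVec, smul_mulVec, mulVec_diagonal, hN] using congrFun h1 k
    have e2 : ∀ k, G k t * v k + (F k t * w k + t * (1 - t) * ((if k = i then w j else 0) -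
        if k = j then w i else 0)) = 0 := by
      intro k
      simpa [add_mulVec, smul_mulVec, mulVec_diagonal, hN] using congrFun h2 k
    have a1 := e1 i
    have a2 := e1 j
    have b1 := e2 i
    have b2 := e2 j
    simp only [F, G, hij, hij.symm, or_true, true_or, if_true, if_false] at a1 a2 b1 b2
    have hq : (1 + (t * (1 - t)) ^ 2 : ℂ) ≠ 0 := by
      norm_cast; positivity
    have hr : ((2 * t - 1) ^ 2 + (t * (1 - t)) ^ 2 : ℂ) ≠ 0 := by
      have : (2 * t - 1) ^ 2 + (t * (1 - t)) ^ 2 ≠ 0 := by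
        intro h0
        have h3 : (2 * t - 1) = 0 := by nlinarith [sq_nonneg (2 * t - 1), sq_nonneg (t * (1 - t))]
        have h4 : t = 1 / 2 := by linarith
        subst h4; norm_num at h0
      exact_mod_cast this
    have x1 : v i + w i = 0 := by
      apply (mul_eq_zero.1 _).resolve_left hq
      linear_combination a1 + b1 - (t * (1 - t)) * (a2 + b2)
    have x2 : v j + w j = 0 := by
      apply (mul_eq_zero.1 _).resolve_left hq
      linear_combination a2 + b2 + (t * (1 - t)) * (a1 + b1)
    have y1 : v i - w i = 0 := by
      apply (mul_eq_zero.1 _).resolve_left hr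
      linear_combination (2 * t - 1) * (a1 - b1) - (t * (1 - t)) * (a2 - b2)
    have y2 : v j - w j = 0 := by
      apply (mul_eq_zero.1 _).resolve_left hr
      linear_combination (2 * t - 1) * (a2 - b2) + (t * (1 - t)) * (a1 - b1)
    have z1 : v i = 0 := by linear_combination (x1 + y1) / 2
    have z2 : w i = 0 := by linear_combination (x1 - y1) / 2
    have z3 : v j = 0 := by linear_combination (x2 + y2) / 2
    have z4 : w j = 0 := by linear_combination (x2 - y2) / 2
    have : ∀ k, v k = 0 ∧ w k = 0 := by
      intro k
      by_cases hki : k = i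
      · subst hki; exact ⟨z1, z2⟩
      by_cases hkj : k = j
      · subst hkj; exact ⟨z3, z4⟩
      have c1 := e1 k
      have c2 := e2 k
      by_cases hk : k ∈ s <;> simp [F, G, hki, hkj, hk] at c1 c2 <;> exact ⟨by assumption, by assumption⟩
    exact ⟨funext fun k => (this k).1, funext fun k => (this k).2⟩
  · simp only [stdFst, Complex.ofReal_zero, zero_mul, zero_smul, add_zero]
    congr 1; funext k
    by_cases hki : k = i
    · subst hki; simp [F, hi]
    by_cases hkj : k = j
    · subst hkj; simp [F, hj]
    simp [F, hki, hkj]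
  · simp only [stdSnd]
    congr 1; funext k
    by_cases hki : k = i
    · subst hki; simp [G, hi]
    by_cases hkj : k = j
    · subst hkj; simp [G, hj]
    simp [G, hki, hkj]
  · simp only [stdFst, Complex.ofReal_one, sub_self, mul_zero, zero_smul, add_zero]
    congr 1; funext k
    by_cases hki : k = i
    · subst hki; simp [F]
    by_cases hkj : k = j
    · subst hkj; simp [F]
    simp [F, hki, hkj]
  · simp only [stdSnd]
    congr 1; funext k
    by_cases hki : k = i
    · subst hki; simp [G]
    by_cases hkj : k = j
    · subst hkj; simp [G]
    simp [G, hki, hkj]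

lemma exists_homotopic_std_card_le_one (s : Finset ι) :
    ∃ s' : Finset ι, s'.card ≤ 1 ∧ Homotopic (stdFst s) (stdSnd s) (stdFst s') (stdSnd s') := by
  induction s using Finset.strongInduction with
  | H s ih =>
    by_cases hs : s.card ≤ 1
    · exact ⟨s, hs, .refl (by simp [stdSnd]) (by simp [det_blk_std])⟩
    · obtain ⟨i, hi, j, hj, hij⟩ := Finset.one_lt_card.1 (not_le.1 hs)
      obtain ⟨s', h1, h2⟩ := ih _
        ((Finset.erase_subset j _).trans_ssubset (Finset.erase_ssubset hi))
      exact ⟨s', h1, (Homotopic.std_erase_pair hi hj hij).trans h2⟩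

/-! ### Diagonalization up to homotopy. -/

/-- A linearly independent family can be completed to an invertible square matrix. -/
lemma exists_matrix_extending {u : κ → ι → ℂ} (hu : LinearIndependent ℂ u) :
    ∃ (ι' : Type) (_ : Fintype ι') (_ : DecidableEq ι') (e : κ ⊕ ι' ≃ ι) (P : Matrix ι ι ℂ),
      P.det ≠ 0 ∧ ∀ j i, P i (e (Sum.inl j)) = u j i := by
  classical
  let b := Module.Basis.sumExtend hu
  have : Finite (κ ⊕ Module.Basis.sumExtendIndex hu) := Module.Finite.finite_basis b
  have : Finite (Module.Basis.sumExtendIndex hu) := Finite.sum_right κ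
  let e : κ ⊕ Module.Basis.sumExtendIndex hu ≃ ι := b.indexEquiv (Pi.basisFun ℂ ι)
  let b' := b.reindex e
  refine ⟨_, Fintype.ofFinite _, inferInstance, e, (Pi.basisFun ℂ ι).toMatrix b', ?_, ?_⟩
  · rw [← Module.Basis.det_apply]
    exact ((Pi.basisFun ℂ ι).isUnit_det b').ne_zero
  · intro j i
    simp only [Module.Basis.toMatrix_apply, b', b, Module.Basis.sumExtend, Pi.basisFun_repr,
      Module.Basis.reindex_apply, Equiv.symm_apply_apply, Module.Basis.extend_apply_self]
    rfl

/-- An invariant subspace of the antilinear map `v ↦ A (conj v)` splits off. -/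
lemma exists_split {A : Matrix ι ι ℂ} (h : (blk A 1).det ≠ 0) {u : κ → ι → ℂ}
    (hu : LinearIndependent ℂ u) (K : Matrix κ κ ℂ)
    (hK : ∀ j, A *ᵥ (fun i => starRingEnd ℂ (u j i)) = ∑ i, K i j • u i) :
    ∃ (ι' : Type) (_ : Fintype ι') (_ : DecidableEq ι') (e : κ ⊕ ι' ≃ ι) (D : Matrix ι' ι' ℂ),
      (blk K 1).det ≠ 0 ∧ (blk D 1).det ≠ 0 ∧
      Homotopic (A.submatrix e e) 1 (fromBlocks K 0 0 D) (fromBlocks 1 0 0 1) := by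
  obtain ⟨ι', _, _, e, P, hP, hPu⟩ := exists_matrix_extending hu
  have h1 := Homotopic.consimilarity h hP
  set A' := P⁻¹ * A * conjM P with hA'
  -- In the basis of columns of `P`, which starts with `u`, invariance of the span of `u` makes the
  -- lower left block vanish.
  have hcol : ∀ j k, A' k (e (Sum.inl j)) = Sum.elim (fun i => K i j) (fun _ => 0) (e.symm k) := by
    intro j k
    set w : ι → ℂ := fun k => Sum.elim (fun i => K i j) (fun _ => 0) (e.symm k) with hw
    have hw' : P *ᵥ w = ∑ i, K i j • u i := by
      funext i
      rw [mulVec, dotProduct, ← e.sum_comp, Fintype.sum_sum_type]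
      simp [hw, hPu, mul_comm]
    have : A' *ᵥ (Pi.single (e (Sum.inl j)) 1) = w := by
      rw [hA', ← mulVec_mulVec, ← mulVec_mulVec, mulVec_single_one]
      have : (conjM P).col (e (Sum.inl j)) = fun i => starRingEnd ℂ (u j i) := by
        funext i; simp [hPu]
      rw [this, hK, ← hw', mulVec_mulVec, nonsing_inv_mul _ (isUnit_iff_ne_zero.2 hP), one_mulVec]
    rw [mulVec_single_one] at this
    exact congrFun this k
  have hblock : A'.submatrix e e = fromBlocks K (A'.submatrix e e).toBlocks₁₂ 0
      (A'.submatrix e e).toBlocks₂₂ := by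
    ext i j
    rcases i with i | i <;> rcases j with j | j <;> simp [hcol, toBlocks₁₂, toBlocks₂₂]
  have h2 := h1.submatrix e
  rw [submatrix_one_equiv, ← fromBlocks_one, hblock] at h2
  have h3 := h2.det_right
  rw [det_blk_fromBlocks] at h3
  have hk := left_ne_zero_of_mul h3
  have hd := right_ne_zero_of_mul h3
  exact ⟨ι', _, _, e, _, hk, hd, fromBlocks_one (l := κ) (m := ι') (α := ℂ) ▸
    h2.trans (.offDiag _ (by simp) (by simp) hk hd)⟩

/-- With entries `l * z` and `conj z`, the matrix `X * conj X` is diagonal with entries `l * z ^ 2`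
and its conjugate. Nondegeneracy thus means `1 - l * z ^ 2 ≠ 0`, a polynomial condition on `z`, and
a complex path from `0` to `1` can avoid its roots. -/
lemma Homotopic.two_by_two {l : ℂ} (h : (blk !![0, l; 1, 0] 1).det ≠ 0) :
    Homotopic !![0, l; 1, 0] 1 (diagonal 0) 1 := by
  have hl : l ≠ 1 := by
    rintro rfl
    apply h
    refine exists_mulVec_eq_zero_iff.1 ⟨Sum.elim ![0, 1] ![-1, 0], fun h0 => ?_, ?_⟩
    · simpa using congrFun h0 (Sum.inl 1)
    · rw [blk, fromBlocks_mulVec]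
      funext i
      rcases i with i | i <;> fin_cases i <;>
        simp [vecHead, vecTail]
  obtain ⟨z, hz, z0, z1, hne⟩ := exists_smooth_path_avoiding_roots
    (1 - Polynomial.C l * Polynomial.X ^ 2) (by simp) (by simpa [sub_eq_zero] using hl.symm)
  have hsz : ContDiff ℝ ((⊤ : ℕ∞) : WithTop ℕ∞) (fun t => starRingEnd ℂ (z t)) :=
    Complex.conjCLE.contDiff.comp hz
  refine Homotopic.symm ⟨fun t => !![0, l * z t; starRingEnd ℂ (z t), 0], fun _ => 1, ?_,
    .const _, fun t ht => ⟨by simp, det_blk_ne_zero_of_ker fun v w h1 h2 => ?_⟩, ?_, rfl, ?_, rfl⟩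
  · intro i j
    fin_cases i <;> fin_cases j
    exacts [contDiff_const, contDiff_const.mul hz, hsz, contDiff_const]
  · have hp : 1 - l * z t ^ 2 ≠ 0 := by simpa using hne t ht
    have hp' : 1 - starRingEnd ℂ l * starRingEnd ℂ (z t) ^ 2 ≠ 0 := by
      simpa using (starRingEnd ℂ).injective.ne hp
    have a0 := congrFun h1 0
    have a1 := congrFun h1 1
    have b0 := congrFun h2 0
    have b1 := congrFun h2 1
    simp [dotProduct, Fin.sum_univ_two] at a0 a1 b0 b1
    have v1 : v 1 = 0 := by
      apply (mul_eq_zero.1 _).resolve_left hp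
      linear_combination b1 - z t * a0
    have v0 : v 0 = 0 := by
      apply (mul_eq_zero.1 _).resolve_left hp'
      linear_combination b0 - starRingEnd ℂ l * starRingEnd ℂ (z t) * a1
    have w0 : w 0 = 0 := by linear_combination a0 - l * z t * v1
    have w1 : w 1 = 0 := by linear_combination a1 - starRingEnd ℂ (z t) * v0
    constructor <;> funext i <;> fin_cases i <;> assumption
  · ext i j; fin_cases i <;> fin_cases j <;> simp [z0]
  · simp [z1]

/-- Glueing diagonal homotopies over a splitting of the index set. -/
lemma Homotopic.glue_diagonal {A : Matrix ι ι ℂ} {ι' : Type} [Fintype ι'] [DecidableEq ι']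
    {e : κ ⊕ ι' ≃ ι} {K : Matrix κ κ ℂ} {D : Matrix ι' ι' ℂ} {k : κ → ℂ} {d : ι' → ℂ}
    (h : Homotopic (A.submatrix e e) 1 (.fromBlocks K 0 0 D) (.fromBlocks 1 0 0 1))
    (hK : Homotopic K 1 (diagonal k) 1) (hD : Homotopic D 1 (diagonal d) 1) :
    ∃ d : ι → ℂ, Homotopic A 1 (diagonal d) 1 := by
  refine ⟨Sum.elim k d ∘ e.symm, ?_⟩
  have := (h.trans (hK.fromBlocks hD)).submatrix e.symm
  rw [fromBlocks_diagonal, fromBlocks_one, submatrix_one_equiv,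
    submatrix_diagonal_equiv] at this
  simpa using this

lemma exists_homotopic_diagonal (n : ℕ) : ∀ (ι : Type) [Fintype ι] [DecidableEq ι],
    Fintype.card ι = n → ∀ A : Matrix ι ι ℂ, (blk A 1).det ≠ 0 →
      ∃ d : ι → ℂ, Homotopic A 1 (diagonal d) 1 := by
  induction n using Nat.strong_induction_on with
  | _ n ih =>
    intro ι _ _ hn A h
    rcases isEmpty_or_nonempty ι with hι | hι
    · refine ⟨0, ?_⟩
      rw [Subsingleton.elim (diagonal 0) A]
      exact .refl (by simp) h
    obtain ⟨l, hl⟩ := Module.End.exists_eigenvalue (toLin' (A * conjM A))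
    obtain ⟨v, hv⟩ := hl.exists_hasEigenvector
    have hv1 : A *ᵥ (conjM A *ᵥ v) = l • v := by
      simpa [← mulVec_mulVec] using hv.apply_eq_smul
    set w := A *ᵥ (fun i => starRingEnd ℂ (v i)) with hw
    have hw1 : A *ᵥ (fun i => starRingEnd ℂ (w i)) = l • v := by
      rw [← hv1]
      congr 1
      funext i
      simp [hw, mulVec, dotProduct]
    -- Since `A (conj v) = w` and `A (conj w) = l • v`, the span of `v` and `w` is invariant. It is
    -- a line when `w` is a multiple of `v`, including `w = 0`.
    by_cases hvw : ∃ a : ℂ, a • v = w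
    · obtain ⟨a, ha⟩ := hvw
      obtain ⟨ι', _, _, e, D, hk, hd, hh⟩ := exists_split h (u := fun _ : Fin 1 => v)
        (linearIndependent_unique_iff.2 hv.2) (diagonal fun _ => a) (fun j => by
          rw [← hw, ← ha, Fin.sum_univ_one, Subsingleton.elim j 0, diagonal_apply_eq])
      have hc : Fintype.card ι' < n := by
        rw [← hn, ← Fintype.card_congr e]; simp
      obtain ⟨d, hd⟩ := ih _ hc ι' rfl D hd
      exact hh.glue_diagonal (.refl (by simp) hk) hd
    · push Not at hvw
      obtain ⟨ι', _, _, e, D, hk, hd, hh⟩ := exists_split h (u := ![v, w])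
        ((LinearIndependent.pair_iff' hv.2).2 hvw) !![0, l; 1, 0] (fun j => by
          fin_cases j
          · simp [← hw]
          · simp [hw1])
      have hc : Fintype.card ι' < n := by
        rw [← hn, ← Fintype.card_congr e]; simp
      obtain ⟨d, hd⟩ := ih _ hc ι' rfl D hd
      exact hh.glue_diagonal (Homotopic.two_by_two hk) hd

/-! ### Normal form and the sign of the determinant. -/

/-- Every nondegenerate pair is homotopic to a diagonal normal form with at most one
hyperbolic summand. -/
theorem exists_homotopic_std {A B : Matrix ι ι ℂ} (hB : Bᵀ = B) (h : (blk A B).det ≠ 0) :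
    ∃ s : Finset ι, s.card ≤ 1 ∧ Homotopic A B (stdFst s) (stdSnd s) := by
  obtain ⟨B', hB', hdet, h1⟩ := exists_homotopic_det_ne_zero hB h
  obtain ⟨P, hP, hPB⟩ := exists_congruence_one hB' hdet
  have h2 := Homotopic.congruence hB' h1.det_right hP
  rw [hPB] at h2
  obtain ⟨d, h3⟩ := exists_homotopic_diagonal _ ι rfl _ h2.det_right
  obtain ⟨s, h4⟩ := exists_homotopic_std_of_diagonal h3.det_right
  obtain ⟨s', hs', h5⟩ := exists_homotopic_std_card_le_one s
  exact ⟨s', hs', h1.trans (h2.trans (h3.trans (h4.trans h5)))⟩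

/-- Congruence by a permutation matrix; it brings the hyperbolic summand to the first coordinate. -/
lemma Homotopic.std_perm (s : Finset ι) (σ : Equiv.Perm ι) :
    Homotopic (stdFst s) (stdSnd s) (stdFst (s.map σ.toEmbedding))
      (stdSnd (s.map σ.toEmbedding)) := by
  have h := Homotopic.congruence (A := stdFst s) (B := stdSnd s) (by simp [stdSnd])
    (by simp [det_blk_std]) (P := σ.permMatrix ℂ) (by simp [det_permutation])
  have key : ∀ f : ι → ℂ, σ⁻¹.permMatrix ℂ * diagonal f * σ.permMatrix ℂ =
      diagonal (f ∘ σ.symm) := by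
    intro f
    rw [PEquiv.toMatrix_toPEquiv_mul, PEquiv.mul_toMatrix_toPEquiv, submatrix_submatrix]
    exact submatrix_diagonal_equiv f σ.symm
  have mem : ∀ k, k ∈ s.map σ.toEmbedding ↔ σ.symm k ∈ s := fun k => Finset.mem_map_equiv
  rw [conjTranspose_permMatrix, transpose_permMatrix] at h
  convert h using 1
  · simp only [stdFst, key, mem]; rfl
  · simp only [stdSnd, key, mem]; rfl

/-- The sign of the determinant is constant along a homotopy. -/
lemma Homotopic.det_re_pos {n : ℕ} {A B A' B' : Matrix (Fin n) (Fin n) ℂ}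
    (h : Homotopic A B A' B') (hpos : 0 < (blk A B).det.re) : 0 < (blk A' B').det.re := by
  obtain ⟨X, Y, hX, hY, h, rfl, rfl, rfl, rfl⟩ := h
  have hc : Continuous fun t => (blk (X t) (Y t)).det.re :=
    Complex.continuous_re.comp (hX.blk hY).det.continuous
  by_contra hneg
  push Not at hneg
  obtain ⟨t, ht, h0⟩ := intermediate_value_Icc' zero_le_one hc.continuousOn ⟨hneg, hpos.le⟩
  exact (h t ht).2 (Complex.ext h0 (blockDet_im (X t, Y t)))

lemma Homotopic.isNondegenerateSmoothHomotopy {n : ℕ} {p q : Pair n}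
    (h : Homotopic p.1 p.2 q.1 q.2) :
    ∃ γ : ℝ → Pair n, IsNondegenerateSmoothHomotopy γ p q := by
  obtain ⟨X, Y, hX, hY, h, h1, h2, h3, h4⟩ := h
  exact ⟨fun t => (X t, Y t), fun i j => (hX i j).contDiffOn, fun i j => (hY i j).contDiffOn,
    fun t ht => (h t ht).1.symm, fun t ht => (h t ht).2, Prod.ext h1 h2, Prod.ext h3 h4⟩

lemma directSum_zero_one_fst (m : ℕ) :
    (directSum ((0, 1) : Pair 1) ((1, 0) : Pair m)).1 = stdFst {Fin.castAdd m 0} := by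
  simp only [directSum, ← diagonal_zero, ← diagonal_one, reindex_apply]
  rw [fromBlocks_diagonal, submatrix_diagonal_equiv, stdFst]
  congr 1
  funext a
  refine Fin.addCases (fun a => ?_) (fun a => ?_) a
  · simp [Subsingleton.elim a 0]
  · simp [Fin.ext_iff]

lemma directSum_zero_one_snd (m : ℕ) :
    (directSum ((0, 1) : Pair 1) ((1, 0) : Pair m)).2 = stdSnd {Fin.castAdd m 0} := by
  simp only [directSum, ← diagonal_zero, ← diagonal_one, reindex_apply]
  rw [fromBlocks_diagonal, submatrix_diagonal_equiv, stdSnd]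
  congr 1
  funext a
  refine Fin.addCases (fun a => ?_) (fun a => ?_) a
  · simp [Subsingleton.elim a 0]
  · simp [Fin.ext_iff]

end MatrixPair

theorem mainTheorem3 :
    (∀ (n : ℕ) (p : MatrixPair.Pair n), MatrixPair.IsElliptic p →
      ∃ γ : ℝ → MatrixPair.Pair n,
        MatrixPair.IsNondegenerateSmoothHomotopy γ p (1, 0)) ∧
    (∀ (m : ℕ) (p : MatrixPair.Pair (1 + m)), MatrixPair.IsHyperbolic p →
      ∃ γ : ℝ → MatrixPair.Pair (1 + m),
        MatrixPair.IsNondegenerateSmoothHomotopy γ p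
          (MatrixPair.directSum ((0, 1) : MatrixPair.Pair 1) ((1, 0) : MatrixPair.Pair m))) := by
  open MatrixPair in
  constructor
  · rintro n p ⟨hp, hpos⟩
    have hpos' : 0 < (blk p.1 p.2).det.re := hpos
    obtain ⟨s, hs, h⟩ := exists_homotopic_std (A := p.1) (B := p.2) hp.symm
      (fun h0 => by simp [h0] at hpos')
    have h1 := h.det_re_pos hpos'
    rw [det_blk_std] at h1
    have hs0 : s = ∅ := by
      rw [← Finset.card_eq_zero]
      by_contra hne
      have : s.card = 1 := by omega
      norm_num [this] at h1
    subst hs0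
    apply Homotopic.isNondegenerateSmoothHomotopy
    simpa [stdFst, stdSnd] using h
  · rintro m p ⟨hp, hneg⟩
    have hneg' : (blk p.1 p.2).det.re < 0 := hneg
    obtain ⟨s, hs, h⟩ := exists_homotopic_std (A := p.1) (B := p.2) hp.symm
      (fun h0 => by simp [h0] at hneg')
    have hs1 : s.card = 1 := by
      by_contra hne
      have h0 : s = ∅ := by rw [← Finset.card_eq_zero]; omega
      subst h0
      -- Without a hyperbolic summand the normal form has determinant `1`, and the reversed homotopy
      -- would make that of `p` positive.
      have := h.symm.det_re_pos (by simp [det_blk_std])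
      linarith
    obtain ⟨i, rfl⟩ := Finset.card_eq_one.1 hs1
    have h2 := h.trans (Homotopic.std_perm {i} (Equiv.swap i (Fin.castAdd m 0)))
    apply Homotopic.isNondegenerateSmoothHomotopy
    rw [Finset.map_singleton, Equiv.coe_toEmbedding, Equiv.swap_apply_left] at h2
    rwa [directSum_zero_one_fst, directSum_zero_one_snd]
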